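/- A skew shape $\lambda/\mu$ consists of the boxes of a Young diagram $\lambda$ that do not lie in a Young diagram $\mu\subseteq\lambda$. Its skew Schur function is $s_{\lambda/\mu}=\sum_T x^T$, the sum over all semistandard tableaux $T$ of shape $\lambda/\mu$ (rows weakly increasing, columns strictly increasing), where $x^T=\prod_i x_i^{t_i}$ and $t_i$ is the number of entries of $T$ equal to $i$; for a partition $\nu$ put $s_\nu=s_{\nu/\emptyset}$. There is a unique expansion $s_{\lambda/\mu}=\sum_\nu c^{\lambda}_{\mu,\nu}s_\nu$ with integer coefficients, and the Schur support of $\lambda/\mu$ is $[\lambda/\mu]=\{\nu : c^{\lambda}_{\mu,\nu}>0\}$. A ribbon is a (nonempty) connected skew shape that does not contain a $2\times 2$ block of boxes; write $\alpha=(\alpha_1,\dots,\alpha_m)$ for a ribbon with $m$ rows whose row lengths, from top to bottom, are $\alpha_1,\dots,\alpha_m$. **Proposition.** Let $\alpha=(\alpha_1,\dots,\alpha_m)$ and $\beta$ be ribbons such that $[\alpha]=[\beta]$. Then $\beta=\alpha_\pi$ for some permutation $\pi\in S_m$, where $\alpha_\pi=(\alpha_{\pi^{-1}(1)},\dots,\alpha_{\pi^{-1}(m)})$.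 In particular, $\beta$ also has $m$ rows. -/

import Mathlib

/-- A skew shape `λ / μ`: a pair of Young diagrams with `μ` contained in `λ`.
Cells are pairs `(i, j)` with `i` the row (counted from the top) and `j` the column
(counted from the left), both starting at `0`. -/
structure SkewShape where
  outer : YoungDiagram
  inner : YoungDiagram
  inner_le : inner ≤ outer

namespace SkewShape

/-- The boxes of `λ / μ`. -/
def cells (A : SkewShape) : Finset (ℕ × ℕ) :=
  A.outer.cells \ A.inner.cells

/-- The straight shape `ν`, that is, `ν / ∅`. -/
def straight (ν : YoungDiagram) : SkewShape :=
  ⟨ν, ⊥, bot_le⟩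

/-- A filling is semistandard if its entries increase weakly along rows and strictly
down columns. -/
def IsSemistandard (A : SkewShape) (T : A.cells → ℕ) : Prop :=
  (∀ c d : A.cells, c.1.1 = d.1.1 → c.1.2 ≤ d.1.2 → T c ≤ T d) ∧
    ∀ c d : A.cells, c.1.2 = d.1.2 → c.1.1 < d.1.1 → T c < T d

/-- The content of a filling: `content T k` is the number of boxes with entry `k`. -/
noncomputable def content (A : SkewShape) (T : A.cells → ℕ) : ℕ →₀ ℕ :=
  ∑ c, Finsupp.single (T c) 1

/-- The semistandard tableaux of shape `A` and content `d`. -/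
def tableaux (A : SkewShape) (d : ℕ →₀ ℕ) : Set (A.cells → ℕ) :=
  {T | A.IsSemistandard T ∧ A.content T = d}

/-- There are only finitely many tableaux of given shape and content, so that counting them
with `Set.ncard` is meaningful. -/
theorem tableaux_finite (A : SkewShape) (d : ℕ →₀ ℕ) : (A.tableaux d).Finite := by
  refine (Set.Finite.pi' (fun _ : A.cells => d.support.finite_toSet)).subset ?_
  rintro T ⟨-, rfl⟩ c
  simp only [Finset.mem_coe, Finsupp.mem_support_iff, content, Finsupp.finsetSum_apply]
  intro h
  have := (Finset.sum_eq_zero_iff.mp h) c (Finset.mem_univ c)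
  simp at this

/-- The skew Schur function `∑ x ^ T`, the sum over all semistandard tableaux `T` of shape `A`,
as a formal power series in infinitely many variables: the coefficient of the monomial `x ^ d` is
the number of tableaux of content `d`. Entries and variables are indexed by `0, 1, 2, …`. -/
noncomputable def schur (A : SkewShape) : MvPowerSeries ℕ ℤ :=
  fun d => ((A.tableaux d).ncard : ℤ)

/-- `c` is the family of coefficients of an expansion of the skew Schur function of `A` as a
linear combination of the Schur functions of straight shapes. -/
def IsSchurExpansion (A : SkewShape) (c : YoungDiagram →₀ ℤ) : Prop :=
  A.schur = c.sum fun ν a => a • (straight ν).schur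

/-- The Schur support of `A`: the straight shapes with positive coefficient in the (unique)
expansion of the skew Schur function of `A` into Schur functions of straight shapes. -/
def schurSupport (A : SkewShape) : Set YoungDiagram :=
  {ν | ∃ c : YoungDiagram →₀ ℤ, A.IsSchurExpansion c ∧ 0 < c ν}

/-- The graph on the boxes of `A` in which two boxes are adjacent when they share an edge. -/
def cellGraph (A : SkewShape) : SimpleGraph A.cells :=
  SimpleGraph.fromRel fun c d =>
    (c.1.1 = d.1.1 ∧ c.1.2 + 1 = d.1.2) ∨ (c.1.2 = d.1.2 ∧ c.1.1 + 1 = d.1.1)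

/-- A ribbon is a connected skew shape that does not contain a `2 × 2` block. -/
def IsRibbon (A : SkewShape) : Prop :=
  A.cellGraph.Connected ∧
    ¬ ∃ i j : ℕ, (i, j) ∈ A.cells ∧ (i, j + 1) ∈ A.cells ∧
      (i + 1, j) ∈ A.cells ∧ (i + 1, j + 1) ∈ A.cells

/-- The number of boxes of `A` in row `i`. -/
def rowLength (A : SkewShape) (i : ℕ) : ℕ :=
  (A.cells.filter fun c => c.1 = i).card

/-- The lengths of the nonempty rows of `A`, from top to bottom. -/
def rowLengths (A : SkewShape) : List ℕ :=
  ((List.range (A.outer.colLen 0)).map A.rowLength).filter fun r => r ≠ 0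

end SkewShape

/-- For `α = (α₁, …, αₘ)` and a permutation `π` of the indices, the sequence
`α_π = (α_{π⁻¹(1)}, …, α_{π⁻¹(m)})`. -/
def permuteRows (α : List ℕ) (π : Equiv.Perm (Fin α.length)) : List ℕ :=
  List.ofFn fun i => α.get (π⁻¹ i)

open Finset MvPolynomial

namespace SkewShape

/-- The sum of all monomials of degree `a - b` in the variables `x₀, …, xₙ₋₁`
(zero if `a < b`), defined by splitting off the last variable. -/
noncomputable def truncComplete : ℕ → ℕ → ℕ → MvPolynomial ℕ ℤ
  | 0, a, b => if a = b then 1 else 0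
  | n + 1, a, b => ∑ k ∈ range (a + 1), X n ^ (a - k) * truncComplete n k b

theorem truncComplete_zero (a b : ℕ) : truncComplete 0 a b = if a = b then 1 else 0 := rfl

theorem truncComplete_succ (n a b : ℕ) :
    truncComplete (n + 1) a b = ∑ k ∈ range (a + 1), X n ^ (a - k) * truncComplete n k b := rfl

theorem truncComplete_of_lt (n : ℕ) {a b : ℕ} (h : a < b) : truncComplete n a b = 0 := by
  induction n generalizing a with
  | zero => rw [truncComplete_zero, if_neg h.ne]
  | succ n ih =>
    rw [truncComplete_succ]
    refine sum_eq_zero fun k hk => ?_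
    rw [ih (by rw [mem_range] at hk; omega), mul_zero]

theorem truncComplete_self (n a : ℕ) : truncComplete n a a = 1 := by
  induction n with
  | zero => simp [truncComplete_zero]
  | succ n ih =>
    rw [truncComplete_succ, sum_range_succ, sum_eq_zero, ih]
    · simp
    · intro k hk
      rw [truncComplete_of_lt n (mem_range.mp hk), mul_zero]

theorem truncComplete_add_one (n a b : ℕ) :
    truncComplete n (a + 1) (b + 1) = truncComplete n a b := by
  induction n generalizing a with
  | zero => simp [truncComplete_zero]
  | succ n ih =>
    rw [truncComplete_succ, sum_range_succ', truncComplete_of_lt n (Nat.succ_pos b), mul_zero,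
      add_zero, truncComplete_succ]
    exact sum_congr rfl fun k _ => by rw [ih, Nat.add_sub_add_right]

theorem truncComplete_eq_sub (n : ℕ) {a b : ℕ} (h : b ≤ a) :
    truncComplete n a b = truncComplete n (a - b) 0 := by
  obtain ⟨c, rfl⟩ := Nat.exists_eq_add_of_le h
  rw [Nat.add_sub_cancel_left]
  induction b with
  | zero => rw [Nat.zero_add]
  | succ b ih => rw [show b + 1 + c = (b + c) + 1 by omega, truncComplete_add_one, ih (by omega)]

theorem truncComplete_succ_eq_add (n : ℕ) {a a' : ℕ} (h : a ≤ a') (b : ℕ) :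
    truncComplete (n + 1) a' b = ∑ k ∈ Ioc a a', X n ^ (a' - k) * truncComplete n k b
      + X n ^ (a' - a) * truncComplete (n + 1) a b := by
  rw [truncComplete_succ, truncComplete_succ, mul_sum,
    ← sum_range_add_sum_Ico _ (by omega : a + 1 ≤ a' + 1), add_comm]
  congr 1
  · refine sum_congr ?_ fun _ _ => rfl
    ext k
    simp only [mem_Ico, mem_Ioc]
    omega
  · refine sum_congr rfl fun k hk => ?_
    rw [← mul_assoc, ← pow_add]
    rw [mem_range] at hk
    congr 2
    omega

/-- The determinant of the complete homogeneous polynomials `h_{aᵢ - bⱼ}` in `n` variables. -/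
noncomputable def jacobiTrudi (n : ℕ) {m : ℕ} (a b : Fin m → ℕ) : MvPolynomial ℕ ℤ :=
  (Matrix.of fun i j => truncComplete n (a i) (b j)).det

/-- The possible values at `i` of a sequence that interlaces `a`. -/
def interlaceSet {m : ℕ} (a : Fin m → ℕ) (i : Fin m) : Finset ℕ :=
  if _h : (i : ℕ) = 0 then range (a i + 1)
  else Ioc (a ⟨i - 1, (Nat.sub_le _ _).trans_lt i.2⟩) (a i)

/-- The sequences that interlace `a`. -/
def interlacing {m : ℕ} (a : Fin m → ℕ) : Finset (Fin m → ℕ) :=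
  Fintype.piFinset (interlaceSet a)

theorem le_of_mem_interlacing {m : ℕ} {a k : Fin m → ℕ} (hk : k ∈ interlacing a) (i : Fin m) :
    k i ≤ a i := by
  have := Fintype.mem_piFinset.mp hk i
  unfold interlaceSet at this
  split_ifs at this
  · exact Nat.lt_succ_iff.mp (mem_range.mp this)
  · exact (mem_Ioc.mp this).2

theorem mem_interlacing_iff {m : ℕ} {a k : Fin m → ℕ} :
    k ∈ interlacing a ↔ (∀ i, k i ≤ a i) ∧ ∀ i j : Fin m, (i : ℕ) + 1 = j → a i < k j := by
  constructor
  · refine fun hk => ⟨le_of_mem_interlacing hk, fun i j hij => ?_⟩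
    have := Fintype.mem_piFinset.mp hk j
    rw [interlaceSet, dif_neg (by omega)] at this
    have hi : i = ⟨j - 1, (Nat.sub_le _ _).trans_lt j.2⟩ := Fin.ext (by simp only; omega)
    rw [hi]
    exact (mem_Ioc.mp this).1
  · rintro ⟨h1, h2⟩
    refine Fintype.mem_piFinset.mpr fun i => ?_
    unfold interlaceSet
    split_ifs with h
    · exact mem_range.mpr (Nat.lt_succ_iff.mpr (h1 i))
    · exact mem_Ioc.mpr ⟨h2 _ _ (by simp only; omega), h1 i⟩

theorem jacobiTrudi_zero {m : ℕ} {a b : Fin m → ℕ} (ha : StrictMono a) (hb : StrictMono b) :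
    jacobiTrudi 0 a b = if a = b then 1 else 0 := by
  unfold jacobiTrudi
  split_ifs with h
  · subst h
    rw [← Matrix.det_one (n := Fin m)]
    congr 1
    ext1 i j
    simp [truncComplete_zero, Matrix.one_apply, ha.injective.eq_iff]
  · by_cases h' : Set.range a ⊆ Set.range b
    · refine absurd ?_ h
      have hr : Set.range a = Set.range b := by
        refine Set.eq_of_subset_of_ncard_le h' ?_ (Set.finite_range b)
        rw [← Set.image_univ, ← Set.image_univ, Set.ncard_image_of_injective _ ha.injective,
          Set.ncard_image_of_injective _ hb.injective]
      exact (StrictMono.range_inj ha hb).mp hr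
    · obtain ⟨_, ⟨i, rfl⟩, hi⟩ := Set.not_subset.mp h'
      refine Matrix.det_eq_zero_of_row_eq_zero i fun j => ?_
      rw [Matrix.of_apply, truncComplete_zero, if_neg fun hij => hi ⟨j, hij.symm⟩]

theorem jacobiTrudi_succ (n : ℕ) {m : ℕ} {a : Fin m → ℕ} (ha : StrictMono a) (b : Fin m → ℕ) :
    jacobiTrudi (n + 1) a b =
      ∑ k ∈ interlacing a, X n ^ (∑ i, (a i - k i)) * jacobiTrudi n k b := by
  have key : jacobiTrudi (n + 1) a b = Matrix.det fun i =>
      ∑ k ∈ interlaceSet a i, (X n : MvPolynomial ℕ ℤ) ^ (a i - k) • fun j => truncComplete n k (b j) := by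
    unfold jacobiTrudi
    cases m with
    | zero => exact Matrix.det_isEmpty.trans Matrix.det_isEmpty.symm
    | succ m =>
      refine Matrix.det_eq_of_forall_row_eq_smul_add_pred
        (fun i => X n ^ (a i.succ - a i.castSucc)) (fun j => ?_) (fun i j => ?_)
      · simp [interlaceSet, truncComplete_succ]
      · rw [Matrix.of_apply, truncComplete_succ_eq_add n (ha (Fin.castSucc_lt_succ (i := i))).le]
        simp only [interlaceSet, Fin.val_succ, Nat.add_eq_zero_iff, one_ne_zero, and_false,
          dif_neg, not_false_eq_true, Finset.sum_apply, Pi.smul_apply, smul_eq_mul, Matrix.of_apply]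
        rfl
  rw [key]
  have := (Matrix.detRowAlternating (R := MvPolynomial ℕ ℤ) (n := Fin m)).toMultilinearMap.map_sum_finset
    (fun i k => (X n : MvPolynomial ℕ ℤ) ^ (a i - k) • fun j => truncComplete n k (b j))
    (interlaceSet a)
  refine this.trans (sum_congr rfl fun k _ => ?_)
  rw [MultilinearMap.map_smul_univ, prod_pow_eq_pow_sum]
  rfl

/-- The row lengths of a diagram with at most `m` rows, from bottom to top, made strictly
increasing by adding the staircase. -/
def shiftedRows (m : ℕ) (ν : YoungDiagram) (i : Fin m) : ℕ :=
  ν.rowLen i.rev + i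

theorem shiftedRows_strictMono (m : ℕ) (ν : YoungDiagram) : StrictMono (shiftedRows m ν) := by
  intro i j h
  have := ν.rowLen_anti j.rev i.rev (Fin.rev_le_rev.mpr h.le)
  have h' : (i : ℕ) < j := h
  unfold shiftedRows
  omega

theorem rowLen_eq_zero {ν : YoungDiagram} {m : ℕ} (h : ν.colLen 0 ≤ m) {i : ℕ} (hi : m ≤ i) :
    ν.rowLen i = 0 := by
  by_contra hne
  have := YoungDiagram.mem_iff_lt_colLen.mp
    (YoungDiagram.mem_iff_lt_rowLen.mpr (Nat.pos_of_ne_zero hne))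
  omega

theorem le_iff_rowLen_le {κ ν : YoungDiagram} : κ ≤ ν ↔ ∀ i, κ.rowLen i ≤ ν.rowLen i := by
  constructor
  · intro h i
    by_contra! hlt
    exact (lt_irrefl _) (YoungDiagram.mem_iff_lt_rowLen.mp
      (h (YoungDiagram.mem_iff_lt_rowLen.mpr hlt)))
  · rintro h ⟨i, j⟩ hij
    exact YoungDiagram.mem_iff_lt_rowLen.mpr ((YoungDiagram.mem_iff_lt_rowLen.mp hij).trans_le (h i))

theorem colLen_mono {κ ν : YoungDiagram} (h : κ ≤ ν) (j : ℕ) : κ.colLen j ≤ ν.colLen j := by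
  by_contra! hlt
  exact (lt_irrefl _) (YoungDiagram.mem_iff_lt_colLen.mp
    (h (YoungDiagram.mem_iff_lt_colLen.mpr hlt)))

theorem rowLen_eq_shiftedRows_sub (ν : YoungDiagram) {m i : ℕ} (hi : i < m) :
    ν.rowLen i = shiftedRows m ν (Fin.rev ⟨i, hi⟩) - (m - 1 - i) := by
  rw [shiftedRows, Fin.rev_rev, Fin.val_rev]
  simp only
  omega

theorem shiftedRows_le_iff {κ ν : YoungDiagram} {m : ℕ} (h : κ.colLen 0 ≤ m) :
    (∀ i, shiftedRows m κ i ≤ shiftedRows m ν i) ↔ κ ≤ ν := by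
  rw [le_iff_rowLen_le]
  constructor
  · intro H i
    by_cases hi : i < m
    · rw [rowLen_eq_shiftedRows_sub κ hi, rowLen_eq_shiftedRows_sub ν hi]
      exact Nat.sub_le_sub_right (H _) _
    · rw [rowLen_eq_zero h (not_lt.mp hi)]
      exact Nat.zero_le _
  · exact fun H i => Nat.add_le_add_right (H _) _

theorem shiftedRows_injective {κ ν : YoungDiagram} {m : ℕ} (hκ : κ.colLen 0 ≤ m)
    (hν : ν.colLen 0 ≤ m) (h : shiftedRows m κ = shiftedRows m ν) : κ = ν :=
  le_antisymm ((shiftedRows_le_iff hκ).mp fun i => (congrFun h i).le)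
    ((shiftedRows_le_iff hν).mp fun i => (congrFun h i).ge)

theorem exists_shiftedRows_eq {m : ℕ} {a : Fin m → ℕ} (ha : StrictMono a) :
    ∃ κ : YoungDiagram, κ.colLen 0 ≤ m ∧ shiftedRows m κ = a := by
  have hstep : ∀ i j : Fin m, i ≤ j → (j : ℕ) - i ≤ a j - a i := by
    intro i j hij
    obtain ⟨j, hj⟩ := j
    induction j with
    | zero => simp
    | succ j ih =>
      rcases eq_or_lt_of_le hij with h | h
      · subst h; simp
      · have hi : i ≤ ⟨j, by omega⟩ := Nat.lt_succ_iff.mp h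
        have := ih (by omega) hi
        have h1 : a i ≤ a ⟨j, by omega⟩ := ha.monotone hi
        have h2 : a ⟨j, by omega⟩ < a ⟨j + 1, hj⟩ := ha (Nat.lt_succ_self j)
        have h3 : (i : ℕ) ≤ j := hi
        simp only at this ⊢
        omega
  have hle : ∀ i : Fin m, (i : ℕ) ≤ a i := by
    intro i
    have := hstep ⟨0, i.pos⟩ i (Nat.zero_le _)
    simp only at this
    omega
  let w : List ℕ := List.ofFn fun i : Fin m => a i.rev - (i.rev : ℕ)
  have hw : w.SortedGE := by
    refine List.sortedGE_ofFn_iff.mpr fun i j hij => ?_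
    have := hstep j.rev i.rev (Fin.rev_le_rev.mpr hij)
    have h1 := ha.monotone (Fin.rev_le_rev.mpr hij)
    have h2 := hle j.rev
    have h3 : (j.rev : ℕ) ≤ i.rev := Fin.rev_le_rev.mpr hij
    omega
  have hlen : w.length = m := List.length_ofFn
  refine ⟨YoungDiagram.ofRowLens w hw, ?_, ?_⟩
  · by_contra! hlt
    obtain ⟨h, -⟩ := YoungDiagram.mem_ofRowLens.mp (YoungDiagram.mem_iff_lt_colLen.mpr hlt)
    simp only at h
    omega
  · ext i
    have := YoungDiagram.rowLen_ofRowLens (hw := hw) ⟨i.rev, by rw [hlen]; exact i.rev.2⟩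
    simp only at this
    rw [shiftedRows, this]
    simp only [w, Fin.getElem_fin, List.getElem_ofFn, Fin.eta, Fin.rev_rev]
    have := hle i
    omega

theorem shiftedRows_mem_interlacing_iff {κ ν : YoungDiagram} {m : ℕ} (hκ : κ.colLen 0 ≤ m)
    (hν : ν.colLen 0 ≤ m) : shiftedRows m κ ∈ interlacing (shiftedRows m ν) ↔
      κ ≤ ν ∧ ∀ i j, (i + 1, j) ∈ ν → (i, j) ∈ κ := by
  rw [mem_interlacing_iff, shiftedRows_le_iff hκ]
  refine and_congr_right fun _ => ⟨fun H i j hij => ?_, fun H i j hij => ?_⟩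
  · rw [YoungDiagram.mem_iff_lt_rowLen] at hij ⊢
    have hi : i + 1 < m := by
      by_contra! h
      rw [rowLen_eq_zero hν h] at hij
      omega
    have := H (Fin.rev ⟨i + 1, hi⟩) (Fin.rev ⟨i, by omega⟩) (by simp only [Fin.val_rev]; omega)
    simp only [shiftedRows, Fin.rev_rev, Fin.val_rev] at this
    omega
  · have hji : (i.rev : ℕ) = j.rev + 1 := by simp only [Fin.val_rev]; omega
    have : ν.rowLen i.rev ≤ κ.rowLen j.rev := by
      rw [hji]
      by_contra! hlt
      exact (lt_irrefl _) (YoungDiagram.mem_iff_lt_rowLen.mp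
        (H _ _ (YoungDiagram.mem_iff_lt_rowLen.mpr hlt)))
    unfold shiftedRows
    omega

theorem card_eq_sum_rowLen {ν : YoungDiagram} {m : ℕ} (h : ν.colLen 0 ≤ m) :
    ν.card = ∑ i : Fin m, ν.rowLen i := by
  rw [Fin.sum_univ_eq_sum_range]
  have : (ν.cells : Set (ℕ × ℕ)).MapsTo Prod.fst (range m) := fun c hc => by
    rw [mem_coe, mem_range]
    by_contra! hlt
    have := YoungDiagram.mem_iff_lt_rowLen.mp (show (c.1, c.2) ∈ ν from hc)
    rw [rowLen_eq_zero h hlt] at this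
    omega
  rw [YoungDiagram.card, card_eq_sum_card_fiberwise this]
  exact sum_congr rfl fun i _ => (ν.rowLen_eq_card).symm

theorem sum_shiftedRows_sub {κ ν : YoungDiagram} {m : ℕ} (hκν : κ ≤ ν) (hν : ν.colLen 0 ≤ m) :
    ∑ i, (shiftedRows m ν i - shiftedRows m κ i) = (ν.cells \ κ.cells).card := by
  have hκ := (colLen_mono hκν 0).trans hν
  rw [card_sdiff_of_subset (YoungDiagram.cells_subset_iff.mpr hκν)]
  change _ = ν.card - κ.card
  rw [card_eq_sum_rowLen hν, card_eq_sum_rowLen hκ, ← sum_tsub_distrib univ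
    (f := fun i : Fin m => ν.rowLen i) (g := fun i : Fin m => κ.rowLen i) fun i _ =>
      le_iff_rowLen_le.mp hκν i,
    ← Equiv.sum_comp Fin.revPerm]
  exact sum_congr rfl fun i _ => by simp [shiftedRows, Nat.add_sub_add_right]

open Classical in
/-- The semistandard tableaux of shape `A` with entries smaller than `n`. -/
noncomputable def truncTableaux (n : ℕ) (A : SkewShape) : Finset (A.cells → ℕ) :=
  (Fintype.piFinset fun _ => range n).filter A.IsSemistandard

theorem mem_truncTableaux {n : ℕ} {A : SkewShape} {T : A.cells → ℕ} :
    T ∈ truncTableaux n A ↔ (∀ c, T c < n) ∧ A.IsSemistandard T := by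
  simp [truncTableaux]

/-- The skew Schur polynomial of `A` in the variables `x₀, …, xₙ₋₁`. -/
noncomputable def truncSchur (n : ℕ) (A : SkewShape) : MvPolynomial ℕ ℤ :=
  ∑ T ∈ truncTableaux n A, ∏ c, X (T c)

open Classical in
/-- The skew Schur polynomial of `ν / μ`, zero if `μ` is not contained in `ν`. -/
noncomputable def pairSchur (n : ℕ) (ν μ : YoungDiagram) : MvPolynomial ℕ ℤ :=
  if h : μ ≤ ν then truncSchur n ⟨ν, μ, h⟩ else 0

theorem mem_cells {A : SkewShape} {c : ℕ × ℕ} : c ∈ A.cells ↔ c ∈ A.outer ∧ c ∉ A.inner := by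
  simp [cells]

open Classical in
theorem truncSchur_zero (A : SkewShape) :
    truncSchur 0 A = if A.outer = A.inner then 1 else 0 := by
  split_ifs with h
  · have : IsEmpty A.cells := ⟨fun c => by
      have := mem_cells.mp c.2
      rw [h] at this
      exact this.2 this.1⟩
    have ht : truncTableaux 0 A = {isEmptyElim} := by
      ext T
      simp [mem_truncTableaux, IsSemistandard, eq_iff_true_of_subsingleton]
    simp [truncSchur, ht]
  · have : truncTableaux 0 A = ∅ := by
      ext T
      simp only [mem_truncTableaux, Nat.not_lt_zero, notMem_empty, iff_false, not_and]
      intro hT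
      refine absurd (le_antisymm (fun c hc => ?_) A.inner_le) h
      by_contra hc'
      exact hT ⟨c, mem_cells.mpr ⟨hc, hc'⟩⟩
    rw [truncSchur, this, sum_empty]

open Classical in
theorem pairSchur_zero (ν μ : YoungDiagram) : pairSchur 0 ν μ = if ν = μ then 1 else 0 := by
  unfold pairSchur
  split_ifs with h h' h'
  · rw [truncSchur_zero, if_pos h']
  · rw [truncSchur_zero, if_neg h']
  · exact absurd h'.ge h
  · rfl

/-- `κ` consists of the inner boxes of `A` and the boxes with an entry smaller than `n`. -/
def IsLowerPart (A : SkewShape) (T : A.cells → ℕ) (n : ℕ) (κ : YoungDiagram) : Prop :=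
  ∀ c, c ∈ κ ↔ c ∈ A.inner ∨ ∃ h : c ∈ A.cells, T ⟨c, h⟩ < n

theorem IsSemistandard.mono {A : SkewShape} {T : A.cells → ℕ} (hT : A.IsSemistandard T)
    {c d : A.cells} (h1 : c.1.1 ≤ d.1.1) (h2 : c.1.2 ≤ d.1.2) : T c ≤ T d := by
  have he : (d.1.1, c.1.2) ∈ A.cells := by
    refine mem_cells.mpr ⟨A.outer.up_left_mem le_rfl h2 (mem_cells.mp d.2).1, fun h => ?_⟩
    exact (mem_cells.mp c.2).2 (A.inner.up_left_mem h1 le_rfl h)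
  refine le_trans ?_ (hT.1 ⟨_, he⟩ d rfl h2)
  rcases eq_or_lt_of_le h1 with h | h
  · exact hT.1 c ⟨_, he⟩ h le_rfl
  · exact (hT.2 c ⟨_, he⟩ rfl h).le

theorem IsSemistandard.exists_isLowerPart {A : SkewShape} {T : A.cells → ℕ}
    (hT : A.IsSemistandard T) (n : ℕ) : ∃ κ, A.IsLowerPart T n κ := by
  classical
  refine ⟨⟨A.outer.cells.filter fun c => c ∈ A.inner ∨ ∃ h : c ∈ A.cells, T ⟨c, h⟩ < n, ?_⟩, ?_⟩
  · intro c d hdc hc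
    simp only [mem_coe, mem_filter] at hc ⊢
    refine ⟨A.outer.isLowerSet hdc hc.1, ?_⟩
    rcases hc with ⟨h1, h | ⟨h, hn⟩⟩
    · exact Or.inl (A.inner.isLowerSet hdc h)
    · by_cases hd : d ∈ A.inner
      · exact Or.inl hd
      · have hd' : d ∈ A.cells := mem_cells.mpr ⟨A.outer.isLowerSet hdc h1, hd⟩
        exact Or.inr ⟨hd', (hT.mono (c := ⟨d, hd'⟩) (d := ⟨c, h⟩) hdc.1 hdc.2).trans_lt hn⟩
  · intro c
    rw [← YoungDiagram.mem_cells]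
    simp only [mem_filter, YoungDiagram.mem_cells, and_iff_right_iff_imp]
    rintro (h | ⟨h, -⟩)
    · exact A.inner_le h
    · exact (mem_cells.mp h).1

theorem IsLowerPart.unique {A : SkewShape} {T : A.cells → ℕ} {n : ℕ} {κ κ' : YoungDiagram}
    (h : A.IsLowerPart T n κ) (h' : A.IsLowerPart T n κ') : κ = κ' :=
  SetLike.ext fun c => (h c).trans (h' c).symm

theorem IsLowerPart.le_outer {A : SkewShape} {T : A.cells → ℕ} {n : ℕ} {κ : YoungDiagram}
    (h : A.IsLowerPart T n κ) : κ ≤ A.outer := fun c hc => by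
  rcases (h c).mp hc with h | ⟨h, -⟩
  · exact A.inner_le h
  · exact (mem_cells.mp h).1

theorem IsLowerPart.inner_le {A : SkewShape} {T : A.cells → ℕ} {n : ℕ} {κ : YoungDiagram}
    (h : A.IsLowerPart T n κ) : A.inner ≤ κ := fun c hc => (h c).mpr (Or.inl hc)

theorem IsLowerPart.strip {A : SkewShape} {T : A.cells → ℕ} {n : ℕ} {κ : YoungDiagram}
    (h : A.IsLowerPart T n κ) (hT : T ∈ truncTableaux (n + 1) A) {i j : ℕ}
    (hij : (i + 1, j) ∈ A.outer) : (i, j) ∈ κ := by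
  rw [mem_truncTableaux] at hT
  refine (h _).mpr (or_iff_not_imp_left.mpr fun hi => ?_)
  have h1 : (i, j) ∈ A.cells := mem_cells.mpr ⟨A.outer.up_left_mem (Nat.le_succ i) le_rfl hij, hi⟩
  have h2 : (i + 1, j) ∈ A.cells :=
    mem_cells.mpr ⟨hij, fun h => hi (A.inner.up_left_mem (Nat.le_succ i) le_rfl h)⟩
  exact ⟨h1, (hT.2.2 ⟨_, h1⟩ ⟨_, h2⟩ rfl (Nat.lt_succ_self i)).trans_le
    (Nat.lt_succ_iff.mp (hT.1 _))⟩

open Classical in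
/-- Extend a filling by the value `n`. -/
noncomputable def extendFilling (A : SkewShape) (n : ℕ) (T : A.cells → ℕ) (c : ℕ × ℕ) : ℕ :=
  if h : c ∈ A.cells then T ⟨c, h⟩ else n

theorem extendFilling_of_mem {A : SkewShape} {c : ℕ × ℕ} (h : c ∈ A.cells) (n : ℕ)
    (T : A.cells → ℕ) : extendFilling A n T c = T ⟨c, h⟩ := dif_pos h

theorem extendFilling_of_notMem {A : SkewShape} {c : ℕ × ℕ} (h : c ∉ A.cells) (n : ℕ)
    (T : A.cells → ℕ) : extendFilling A n T c = n := dif_neg h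

open Classical in
theorem sum_isLowerPart {ν μ κ : YoungDiagram} (hμν : μ ≤ ν) (hκν : κ ≤ ν)
    (hstrip : ∀ i j, (i + 1, j) ∈ ν → (i, j) ∈ κ) (n : ℕ) :
    ∑ T ∈ truncTableaux (n + 1) ⟨ν, μ, hμν⟩ with IsLowerPart _ T n κ, ∏ c, X (T c) =
      X n ^ (ν.cells \ κ.cells).card * pairSchur n κ μ := by
  by_cases hμκ : μ ≤ κ
  swap
  · rw [pairSchur, dif_neg hμκ, mul_zero, filter_false_of_mem, sum_empty]
    exact fun T _ hT => hμκ hT.inner_le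
  rw [pairSchur, dif_pos hμκ, truncSchur, mul_sum]
  set A : SkewShape := ⟨ν, μ, hμν⟩
  set B : SkewShape := ⟨κ, μ, hμκ⟩
  have hBA : ∀ {c}, c ∈ B.cells → c ∈ A.cells := fun {c} hc =>
    mem_cells.mpr ⟨hκν (mem_cells.mp hc).1, (mem_cells.mp hc).2⟩
  symm
  refine sum_bij' (fun T _ c => extendFilling B n T c) (fun T _ c => T ⟨c.1, hBA c.2⟩)
    ?_ ?_ ?_ ?_ ?_
  · intro T hT
    rw [mem_truncTableaux] at hT
    have hlt : ∀ {c}, extendFilling B n T c < n ↔ c ∈ B.cells := by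
      intro c
      by_cases hc : c ∈ B.cells
      · rw [extendFilling_of_mem hc]
        exact iff_of_true (hT.1 _) hc
      · rw [extendFilling_of_notMem hc]
        exact iff_of_false (lt_irrefl n) hc
    have hle : ∀ {c}, extendFilling B n T c ≤ n := by
      intro c
      by_cases hc : c ∈ B.cells
      · exact (hlt.mpr hc).le
      · exact (extendFilling_of_notMem hc n T).le
    have hB : ∀ {c}, c ∈ κ → c ∈ A.cells → c ∈ B.cells := fun h1 h2 =>
      mem_cells.mpr ⟨h1, (mem_cells.mp h2).2⟩
    rw [mem_filter, mem_truncTableaux]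
    refine ⟨⟨fun c => Nat.lt_succ_iff.mpr hle, fun c d h1 h2 => ?_, fun c d h1 h2 => ?_⟩, ?_⟩
    · by_cases hd : d.1 ∈ B.cells
      · have hc : c.1 ∈ B.cells :=
          hB (κ.up_left_mem h1.le h2 (mem_cells.mp hd).1) c.2
        beta_reduce
        rw [extendFilling_of_mem hc, extendFilling_of_mem hd]
        exact hT.2.1 ⟨_, hc⟩ ⟨_, hd⟩ h1 h2
      · beta_reduce
        rw [extendFilling_of_notMem hd]
        exact hle
    · beta_reduce
      have hc : c.1 ∈ B.cells := hB (hstrip _ _ (ν.up_left_mem h2 h1.le (mem_cells.mp d.2).1)) c.2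
      by_cases hd : d.1 ∈ B.cells
      · rw [extendFilling_of_mem hc, extendFilling_of_mem hd]
        exact hT.2.2 ⟨_, hc⟩ ⟨_, hd⟩ h1 h2
      · rw [extendFilling_of_notMem hd]
        exact hlt.mpr hc
    · intro c
      constructor
      · intro hc
        refine or_iff_not_imp_left.mpr fun hi => ?_
        exact ⟨mem_cells.mpr ⟨hκν hc, hi⟩, hlt.mpr (mem_cells.mpr ⟨hc, hi⟩)⟩
      · rintro (h | ⟨h, hn⟩)
        · exact hμκ h
        · exact (mem_cells.mp (hlt.mp hn)).1
  · intro T hT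
    rw [mem_filter, mem_truncTableaux] at hT
    refine mem_truncTableaux.mpr ⟨fun c => ?_,
      fun c d => hT.1.2.1 ⟨_, hBA c.2⟩ ⟨_, hBA d.2⟩, fun c d => hT.1.2.2 ⟨_, hBA c.2⟩ ⟨_, hBA d.2⟩⟩
    rcases (hT.2 c.1).mp (mem_cells.mp c.2).1 with h | ⟨_, h⟩
    · exact absurd h (mem_cells.mp c.2).2
    · exact h
  · intro T hT
    ext c
    exact extendFilling_of_mem c.2 n T
  · intro T hT
    rw [mem_filter, mem_truncTableaux] at hT
    ext c
    by_cases hc : c.1 ∈ B.cells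
    · exact extendFilling_of_mem hc _ _
    · rw [extendFilling_of_notMem hc]
      refine le_antisymm ?_ (Nat.lt_succ_iff.mp (hT.1.1 c))
      by_contra! hlt
      exact hc (mem_cells.mpr ⟨(hT.2 c.1).mpr (Or.inr ⟨c.2, hlt⟩), (mem_cells.mp c.2).2⟩)
  · intro T hT
    rw [prod_coe_sort A.cells fun c => X (extendFilling B n T c),
      ← prod_sdiff (s₁ := B.cells) (s₂ := A.cells) fun c => hBA,
      ← prod_coe_sort B.cells fun c => X (extendFilling B n T c)]
    congr 1
    · have hs : A.cells \ B.cells = ν.cells \ κ.cells := by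
        ext c
        simp only [mem_sdiff, mem_cells, YoungDiagram.mem_cells, A, B]
        refine ⟨fun h => ⟨h.1.1, fun hc => h.2 ⟨hc, h.1.2⟩⟩, fun h =>
          ⟨⟨h.1, fun hc => h.2 (hμκ hc)⟩, fun hc => h.2 hc.1⟩⟩
      rw [← hs, ← prod_const]
      exact prod_congr rfl fun c hc => by rw [extendFilling_of_notMem (mem_sdiff.mp hc).2]
    · exact prod_congr rfl fun c _ => by rw [extendFilling_of_mem c.2]

theorem pairSchur_succ (n : ℕ) {ν : YoungDiagram} (μ : YoungDiagram) {m : ℕ}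
    (hν : ν.colLen 0 ≤ m) (f : (Fin m → ℕ) → MvPolynomial ℕ ℤ)
    (hf : ∀ κ, κ ≤ ν → f (shiftedRows m κ) = pairSchur n κ μ) :
    pairSchur (n + 1) ν μ = ∑ k ∈ interlacing (shiftedRows m ν),
      X n ^ (∑ i, (shiftedRows m ν i - k i)) * f k := by
  classical
  have hex : ∀ k ∈ interlacing (shiftedRows m ν), ∃ κ, κ.colLen 0 ≤ m ∧ shiftedRows m κ = k := by
    intro k hk
    refine exists_shiftedRows_eq fun i j hij => ?_
    rw [mem_interlacing_iff] at hk
    have h1 := hk.2 ⟨j - 1, by omega⟩ j (by simp only; have : (i : ℕ) < j := hij; omega)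
    refine lt_of_le_of_lt ((hk.1 i).trans ?_) h1
    exact (shiftedRows_strictMono m ν).monotone (by
      have : (i : ℕ) < j := hij
      exact Nat.le_sub_one_of_lt this)
  by_cases hμν : μ ≤ ν
  swap
  · rw [pairSchur, dif_neg hμν]
    refine (sum_eq_zero fun k hk => ?_).symm
    obtain ⟨κ, hκ, rfl⟩ := hex k hk
    have hκν := ((shiftedRows_mem_interlacing_iff hκ hν).mp hk).1
    rw [hf κ hκν, pairSchur, dif_neg fun h => hμν (h.trans hκν), mul_zero]
  rw [pairSchur, dif_pos hμν, truncSchur]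
  have hlow : ∀ T ∈ truncTableaux (n + 1) ⟨ν, μ, hμν⟩, ∃ κ, IsLowerPart _ T n κ :=
    fun T hT => (mem_truncTableaux.mp hT).2.exists_isLowerPart n
  choose! g hg using hlow
  have hcol : ∀ T ∈ truncTableaux (n + 1) ⟨ν, μ, hμν⟩, (g T).colLen 0 ≤ m := fun T hT =>
    (colLen_mono (hg T hT).le_outer 0).trans hν
  rw [← sum_fiberwise_of_maps_to (g := fun T => shiftedRows m (g T))
    (t := interlacing (shiftedRows m ν)) fun T hT =>
      (shiftedRows_mem_interlacing_iff (hcol T hT) hν).mpr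
        ⟨(hg T hT).le_outer, fun i j hij => (hg T hT).strip hT hij⟩]
  refine sum_congr rfl fun k hk => ?_
  obtain ⟨κ, hκ, rfl⟩ := hex k hk
  obtain ⟨hκν, hstrip⟩ := (shiftedRows_mem_interlacing_iff hκ hν).mp hk
  rw [hf κ hκν, sum_shiftedRows_sub hκν hν, ← sum_isLowerPart hμν hκν hstrip]
  refine sum_congr (filter_congr fun T hT => ?_) fun _ _ => rfl
  constructor
  · intro h
    rw [← shiftedRows_injective (hcol T hT) hκ h]
    exact hg T hT
  · intro h
    rw [(hg T hT).unique h]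

/-- The **Jacobi–Trudi formula**. -/
theorem pairSchur_eq_jacobiTrudi (n : ℕ) {ν μ : YoungDiagram} {m : ℕ} (hν : ν.colLen 0 ≤ m)
    (hμ : μ.colLen 0 ≤ m) :
    pairSchur n ν μ = jacobiTrudi n (shiftedRows m ν) (shiftedRows m μ) := by
  induction n generalizing ν with
  | zero =>
    classical
    rw [pairSchur_zero, jacobiTrudi_zero (shiftedRows_strictMono m ν) (shiftedRows_strictMono m μ)]
    exact if_congr ⟨fun h => h ▸ rfl, shiftedRows_injective hν hμ⟩ rfl rfl
  | succ n ih =>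
    rw [jacobiTrudi_succ n (shiftedRows_strictMono m ν)]
    exact pairSchur_succ n μ hν _ fun κ hκ => (ih ((colLen_mono hκ 0).trans hν)).symm

theorem truncSchur_eq_jacobiTrudi (n : ℕ) (A : SkewShape) : truncSchur n A =
    jacobiTrudi n (shiftedRows (A.outer.colLen 0) A.outer)
      (shiftedRows (A.outer.colLen 0) A.inner) := by
  rw [← pairSchur_eq_jacobiTrudi n le_rfl (colLen_mono A.inner_le 0), pairSchur, dif_pos A.inner_le]

/-- The Young diagram whose row lengths are the nonzero elements of a multiset. -/
noncomputable def shapeOf (M : Multiset ℕ) : YoungDiagram :=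
  YoungDiagram.ofRowLens ((M.filter (0 < ·)).sort (· ≥ ·)) (Multiset.pairwise_sort _ _).sortedGE

theorem rowLens_shapeOf (M : Multiset ℕ) :
    ((shapeOf M).rowLens : Multiset ℕ) = M.filter (0 < ·) := by
  rw [shapeOf, YoungDiagram.rowLens_ofRowLens_eq_self, Multiset.sort_eq]
  intro x hx
  exact (Multiset.mem_filter.mp ((Multiset.mem_sort _).mp hx)).2

theorem shapeOf_rowLens (ν : YoungDiagram) : shapeOf ν.rowLens = ν := by
  apply YoungDiagram.equivListRowLens.injective
  refine Subtype.ext (List.Perm.eq_of_sortedGE (shapeOf _).rowLens_sorted ν.rowLens_sorted ?_)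
  rw [← Multiset.coe_eq_coe]
  exact (rowLens_shapeOf _).trans (Multiset.filter_eq_self.mpr fun x hx =>
    ν.pos_of_mem_rowLens x hx)

theorem shapeOf_filter_pos (M : Multiset ℕ) : shapeOf (M.filter (0 < ·)) = shapeOf M := by
  simp [shapeOf]

@[to_additive]
theorem prod_map_filter_pos {α : Type*} [CommMonoid α] {f : ℕ → α} (hf : f 0 = 1)
    (M : Multiset ℕ) : ((M.filter (0 < ·)).map f).prod = (M.map f).prod := by
  induction M using Multiset.induction with
  | empty => simp
  | cons k M ih =>
    rcases Nat.eq_zero_or_pos k with rfl | hk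
    · rw [Multiset.filter_cons_of_neg _ (lt_irrefl 0), ih, Multiset.map_cons, Multiset.prod_cons,
        hf, one_mul]
    · rw [Multiset.filter_cons_of_pos (p := (0 < ·)) _ hk, Multiset.map_cons, Multiset.map_cons,
        Multiset.prod_cons, Multiset.prod_cons, ih]

/-- The sum of the squares of the row lengths. -/
def sqNorm (ν : YoungDiagram) : ℕ :=
  (ν.rowLens.map (· ^ 2)).sum

theorem sqNorm_le (ν : YoungDiagram) : sqNorm ν ≤ ν.rowLens.sum ^ 2 := by
  unfold sqNorm
  induction ν.rowLens with
  | nil => simp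
  | cons k l ih =>
    rw [List.map_cons, List.sum_cons, List.sum_cons]
    nlinarith [Nat.zero_le (k * l.sum)]

theorem sum_rowLens_shapeOf (M : Multiset ℕ) : (shapeOf M).rowLens.sum = M.sum := by
  have := sum_map_filter_pos (f := id) rfl M
  rw [← rowLens_shapeOf, Multiset.map_id, Multiset.map_id, Multiset.sum_coe] at this
  exact this

theorem sqNorm_shapeOf (M : Multiset ℕ) : sqNorm (shapeOf M) = (M.map (· ^ 2)).sum := by
  rw [← sum_map_filter_pos (f := (· ^ 2)) rfl M, ← rowLens_shapeOf, Multiset.map_coe,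
    Multiset.sum_coe, sqNorm]

/-- The products of complete homogeneous polynomials indexed by the rows of `ν`, in any number
of variables. -/
noncomputable def completeSeq (ν : YoungDiagram) (n : ℕ) : MvPolynomial ℕ ℤ :=
  (ν.rowLens.map fun k => truncComplete n k 0).prod

theorem completeSeq_shapeOf (M : Multiset ℕ) (n : ℕ) :
    completeSeq (shapeOf M) n = (M.map fun k => truncComplete n k 0).prod := by
  rw [← prod_map_filter_pos (f := fun k => truncComplete n k 0) (truncComplete_self n 0) M,
    ← rowLens_shapeOf, Multiset.map_coe, Multiset.prod_coe, completeSeq]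

/-- The Schur polynomials of `A`, in any number of variables. -/
noncomputable def schurSeq (A : SkewShape) (n : ℕ) : MvPolynomial ℕ ℤ :=
  truncSchur n A

theorem rowLength_eq (A : SkewShape) (i : ℕ) :
    A.rowLength i = A.outer.rowLen i - A.inner.rowLen i := by
  rw [rowLength, YoungDiagram.rowLen_eq_card, YoungDiagram.rowLen_eq_card,
    ← card_sdiff_of_subset fun c hc => by
      rw [YoungDiagram.mem_row_iff] at hc ⊢; exact ⟨A.inner_le hc.1, hc.2⟩]
  congr 1
  ext c
  simp only [mem_filter, mem_cells, mem_sdiff, YoungDiagram.mem_row_iff]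
  tauto

/-- The straight shape whose rows are the sorted rows of `A`. -/
noncomputable def rowShape (A : SkewShape) : YoungDiagram :=
  shapeOf A.rowLengths

theorem rowShape_eq (A : SkewShape) :
    rowShape A = shapeOf (univ.val.map fun i : Fin (A.outer.colLen 0) =>
      shiftedRows _ A.outer i - shiftedRows _ A.inner i) := by
  rw [rowShape, ← shapeOf_filter_pos (univ.val.map _)]
  congr 1
  have h1 : (univ.val.map fun i : Fin (A.outer.colLen 0) =>
      shiftedRows _ A.outer i - shiftedRows _ A.inner i) =
      ((List.range (A.outer.colLen 0)).map A.rowLength : Multiset ℕ) := by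
    have h2 : (univ.val.map fun i : Fin (A.outer.colLen 0) =>
        shiftedRows _ A.outer i - shiftedRows _ A.inner i) =
        univ.val.map fun i : Fin (A.outer.colLen 0) => A.rowLength i := by
      conv_rhs => rw [← Multiset.map_univ_val_equiv Fin.revPerm, Multiset.map_map]
      exact Multiset.map_congr rfl fun i _ => by
        simp [shiftedRows, rowLength_eq, Nat.add_sub_add_right]
    rw [h2, ← List.map_coe_finRange_eq_range, List.map_map]
    rfl
  rw [h1, Multiset.filter_coe, rowLengths]
  congr 2
  ext r
  simp [Nat.pos_iff_ne_zero]

theorem rowShape_straight (ν : YoungDiagram) : rowShape (straight ν) = ν := by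
  conv_rhs => rw [← shapeOf_rowLens ν]
  rw [rowShape]
  congr 2
  have : (List.range ((straight ν).outer.colLen 0)).map (straight ν).rowLength = ν.rowLens := by
    refine List.map_congr_left fun i _ => ?_
    have h0 : (⊥ : YoungDiagram).rowLen i = 0 := by
      by_contra h
      exact YoungDiagram.notMem_bot _
        (YoungDiagram.mem_iff_lt_rowLen.mpr (Nat.pos_of_ne_zero h))
    rw [rowLength_eq]
    simp [straight, h0]
  rw [rowLengths, this, List.filter_eq_self]
  intro x hx
  simpa using (ν.pos_of_mem_rowLens x hx).ne'

theorem sum_sq_sub_lt {m : ℕ} {a b : Fin m → ℕ} (ha : StrictMono a) (hb : StrictMono b)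
    (hba : ∀ i, b i ≤ a i) {σ : Equiv.Perm (Fin m)} (hσ : σ ≠ 1) (hσba : ∀ i, b i ≤ a (σ i)) :
    ∑ i, (a i - b i) ^ 2 < ∑ i, (a (σ i) - b i) ^ 2 := by
  have hmono : Monovary b a := fun i j h => hb.monotone (ha.lt_iff_lt.mp h).le
  have hnot : ¬ Monovary b (a ∘ σ) := by
    intro h
    refine hσ (inv_eq_one.mp ((Equiv.Perm.monotone_iff σ⁻¹).mp fun i j hij => ?_))
    rcases eq_or_lt_of_le hij with rfl | hlt
    · exact le_rfl
    · exact hb.le_iff_le.mp (h (by simpa using ha hlt))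
  have key := hmono.sum_mul_comp_perm_lt_sum_mul_iff.mpr hnot
  have hperm : ∑ i, a (σ i) ^ 2 = ∑ i, a i ^ 2 := Equiv.sum_comp σ fun i => a i ^ 2
  have e : ∀ τ : Equiv.Perm (Fin m), (∀ i, b i ≤ a (τ i)) →
      ∑ i, (a (τ i) - b i) ^ 2 + 2 * ∑ i, b i * a (τ i) = ∑ i, a (τ i) ^ 2 + ∑ i, b i ^ 2 := by
    intro τ hτ
    rw [mul_sum, ← sum_add_distrib, ← sum_add_distrib]
    refine sum_congr rfl fun i _ => ?_
    obtain ⟨c, hc⟩ := Nat.exists_eq_add_of_le (hτ i)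
    rw [hc, Nat.add_sub_cancel_left]
    ring
  have e1 := e 1 hba
  have e2 := e σ hσba
  simp only [Equiv.Perm.coe_one, id_eq] at e1
  omega

theorem schurSeq_sub_mem_span (A : SkewShape) :
    schurSeq A - completeSeq (rowShape A) ∈ Submodule.span ℤ (completeSeq ''
      {κ | κ.rowLens.sum = (rowShape A).rowLens.sum ∧ sqNorm (rowShape A) < sqNorm κ}) := by
  classical
  set m := A.outer.colLen 0
  set a := shiftedRows m A.outer
  set b := shiftedRows m A.inner
  have ha : StrictMono a := shiftedRows_strictMono m _
  have hb : StrictMono b := shiftedRows_strictMono m _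
  have hba : ∀ i, b i ≤ a i := (shiftedRows_le_iff (colLen_mono A.inner_le 0)).mpr A.inner_le
  let t (σ : Equiv.Perm (Fin m)) (n : ℕ) : MvPolynomial ℕ ℤ :=
    ∏ i, truncComplete n (a (σ i)) (b i)
  have ht : ∀ σ : Equiv.Perm (Fin m), (∀ i, b i ≤ a (σ i)) →
      t σ = completeSeq (shapeOf (univ.val.map fun i => a (σ i) - b i)) := by
    intro σ hσ
    ext1 n
    rw [completeSeq_shapeOf, Multiset.map_map]
    exact prod_congr rfl fun i _ => truncComplete_eq_sub n (hσ i)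
  have hone : t 1 = completeSeq (rowShape A) := by
    rw [ht 1 hba, rowShape_eq]
    rfl
  have hS : schurSeq A = ∑ σ, (Equiv.Perm.sign σ : ℤ) • t σ := by
    ext1 n
    rw [schurSeq, truncSchur_eq_jacobiTrudi, jacobiTrudi, Matrix.det_apply', Finset.sum_apply]
    refine sum_congr rfl fun σ _ => ?_
    rw [Pi.smul_apply, zsmul_eq_mul]
    rfl
  rw [hS, ← hone, ← add_sum_erase _ _ (mem_univ 1), Equiv.Perm.sign_one, Units.val_one, one_smul,
    add_sub_cancel_left]
  refine Submodule.sum_mem _ fun σ hσ => Submodule.smul_mem _ _ ?_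
  by_cases hle : ∀ i, b i ≤ a (σ i)
  · rw [ht σ hle]
    refine Submodule.subset_span ⟨_, ⟨?_, ?_⟩, rfl⟩
    · rw [rowShape_eq, sum_rowLens_shapeOf, sum_rowLens_shapeOf]
      change ∑ i, (a (σ i) - b i) = ∑ i, (a i - b i)
      rw [sum_tsub_distrib _ fun i _ => hle i, sum_tsub_distrib _ fun i _ => hba i,
        Equiv.sum_comp σ a]
    · rw [rowShape_eq, sqNorm_shapeOf, sqNorm_shapeOf, Multiset.map_map, Multiset.map_map]
      exact sum_sq_sub_lt ha hb hba (ne_of_mem_erase hσ) hle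
  · obtain ⟨i, hi⟩ := not_forall.mp hle
    have : t σ = 0 := by
      ext1 n
      exact prod_eq_zero (mem_univ i) (truncComplete_of_lt n (not_le.mp hi))
    rw [this]
    exact Submodule.zero_mem _

/-- The span of the Schur functions of the diagrams of the same size as `ν` and larger norm. -/
noncomputable def upperSpan (ν : YoungDiagram) : Submodule ℤ (ℕ → MvPolynomial ℕ ℤ) :=
  Submodule.span ℤ ((fun κ => schurSeq (straight κ)) ''
    {κ | κ.rowLens.sum = ν.rowLens.sum ∧ sqNorm ν < sqNorm κ})

theorem completeSeq_sub_mem_upperSpan (ν : YoungDiagram) :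
    completeSeq ν - schurSeq (straight ν) ∈ upperSpan ν := by
  induction h : ν.rowLens.sum ^ 2 - sqNorm ν using Nat.strong_induction_on generalizing ν with
  | _ d ih =>
    have hs := schurSeq_sub_mem_span (straight ν)
    rw [rowShape_straight] at hs
    rw [← neg_sub]
    refine Submodule.neg_mem _ (Submodule.span_le.mpr ?_ hs)
    rintro _ ⟨κ, ⟨hsum, hlt⟩, rfl⟩
    have hκ := ih _ (by have := sqNorm_le κ; rw [hsum] at this ⊢; omega) κ rfl
    rw [SetLike.mem_coe, ← sub_add_cancel (completeSeq κ) (schurSeq (straight κ))]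
    refine Submodule.add_mem _ (Submodule.span_mono ?_ hκ)
      (Submodule.subset_span ⟨κ, ⟨hsum, hlt⟩, rfl⟩)
    exact Set.image_mono fun ρ hρ => ⟨hρ.1.trans hsum, hlt.trans hρ.2⟩

theorem schurSeq_sub_mem_upperSpan (A : SkewShape) :
    schurSeq A - schurSeq (straight (rowShape A)) ∈ upperSpan (rowShape A) := by
  rw [← sub_add_sub_cancel _ (completeSeq (rowShape A))]
  refine Submodule.add_mem _ (Submodule.span_le.mpr ?_ (schurSeq_sub_mem_span A))
    (completeSeq_sub_mem_upperSpan _)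
  rintro _ ⟨κ, ⟨hsum, hlt⟩, rfl⟩
  rw [SetLike.mem_coe, ← sub_add_cancel (completeSeq κ) (schurSeq (straight κ))]
  refine Submodule.add_mem _ (Submodule.span_mono ?_ (completeSeq_sub_mem_upperSpan κ))
    (Submodule.subset_span ⟨κ, ⟨hsum, hlt⟩, rfl⟩)
  exact Set.image_mono fun ρ hρ => ⟨hρ.1.trans hsum, hlt.trans hρ.2⟩

theorem coeff_truncSchur (A : SkewShape) {n : ℕ} {d : ℕ →₀ ℕ} (hd : d.support ⊆ range n) :
    (truncSchur n A).coeff d = (A.tableaux d).ncard := by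
  classical
  have hT : A.tableaux d = ((truncTableaux n A).filter fun T => A.content T = d : Finset _) := by
    ext T
    rw [mem_coe, mem_filter, mem_truncTableaux]
    refine ⟨fun h => ⟨⟨fun c => mem_range.mp (hd ?_), h.1⟩, h.2⟩, fun h => ⟨h.1.2, h.2⟩⟩
    rw [← h.2, Finsupp.mem_support_iff, content, Finsupp.finsetSum_apply]
    intro h0
    simpa using sum_eq_zero_iff.mp h0 c (mem_univ c)
  have hprod : ∀ T : A.cells → ℕ,
      ∏ c, (X (T c) : MvPolynomial ℕ ℤ) = monomial (A.content T) 1 := fun T => by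
    rw [content, monomial_sum_one]
    rfl
  rw [hT, Set.ncard_coe_finset, truncSchur, coeff_sum, card_filter]
  rw [Nat.cast_sum]
  exact sum_congr rfl fun T _ => by
    rw [hprod, coeff_monomial, Nat.cast_ite, Nat.cast_one, Nat.cast_zero]

theorem isSchurExpansion_of_schurSeq {A : SkewShape} {c : YoungDiagram →₀ ℤ}
    (h : schurSeq A = c.sum fun ν a => a • schurSeq (straight ν)) : A.IsSchurExpansion c := by
  refine MvPowerSeries.ext fun d => ?_
  obtain ⟨n, hn⟩ : ∃ n, d.support ⊆ range n := d.support.exists_nat_subset_range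
  have h1 := congrArg (coeff d) (congrFun h n)
  rw [schurSeq, coeff_truncSchur A hn, Finsupp.sum, Finset.sum_apply, coeff_sum] at h1
  rw [Finsupp.sum, map_sum]
  refine h1.trans (sum_congr rfl fun ν _ => ?_)
  rw [Pi.smul_apply, coeff_smul, schurSeq, coeff_truncSchur _ hn, map_zsmul]
  rfl

theorem rowLength_straight (ν : YoungDiagram) (i : ℕ) : (straight ν).rowLength i = ν.rowLen i := by
  rw [YoungDiagram.rowLen_eq_card, rowLength]
  congr 1
  ext c
  simp [mem_cells, straight, YoungDiagram.mem_row_iff]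

theorem row_le_of_isSemistandard {ν : YoungDiagram} {T : (straight ν).cells → ℕ}
    (hT : (straight ν).IsSemistandard T) (c : (straight ν).cells) : c.1.1 ≤ T c := by
  obtain ⟨⟨i, j⟩, hc⟩ := c
  induction i with
  | zero => exact Nat.zero_le _
  | succ i ih =>
    have hc' : (i, j) ∈ (straight ν).cells := mem_cells.mpr
      ⟨ν.up_left_mem (Nat.le_succ i) le_rfl (mem_cells.mp hc).1, YoungDiagram.notMem_bot _⟩
    exact (ih hc').trans_lt (hT.2 ⟨_, hc'⟩ ⟨_, hc⟩ rfl (Nat.lt_succ_self i))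

/-- The filling of `ν` in which all entries of row `i` equal `i`. -/
def rowFilling (ν : YoungDiagram) (c : (straight ν).cells) : ℕ := c.1.1

theorem rowFilling_isSemistandard (ν : YoungDiagram) :
    (straight ν).IsSemistandard (rowFilling ν) :=
  ⟨fun _ _ h _ => h.le, fun _ _ _ h => h⟩

theorem content_rowFilling (ν : YoungDiagram) (i : ℕ) :
    (straight ν).content (rowFilling ν) i = ν.rowLen i := by
  rw [← rowLength_straight, rowLength, card_filter, content, Finsupp.finsetSum_apply,
    ← sum_coe_sort (straight ν).cells fun c => if c.1 = i then 1 else 0]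
  exact sum_congr rfl fun c _ => Finsupp.single_apply

theorem content_rowFilling_injective {κ ν : YoungDiagram}
    (h : (straight κ).content (rowFilling κ) = (straight ν).content (rowFilling ν)) : κ = ν := by
  have hr : ∀ i, κ.rowLen i = ν.rowLen i := fun i => by
    rw [← content_rowFilling, h, content_rowFilling]
  exact le_antisymm (le_iff_rowLen_le.mpr fun i => (hr i).le)
    (le_iff_rowLen_le.mpr fun i => (hr i).ge)

theorem linearCombination_content (A : SkewShape) (T : A.cells → ℕ) :
    Finsupp.linearCombination ℕ (id : ℕ → ℕ) (A.content T) = ∑ c, T c := by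
  rw [content, map_sum]
  exact sum_congr rfl fun c _ => by simp

theorem eq_rowFilling_of_sum_le {ν : YoungDiagram} {T : (straight ν).cells → ℕ}
    (hT : (straight ν).IsSemistandard T) (h : ∑ c, T c ≤ ∑ c, rowFilling ν c) :
    T = rowFilling ν := by
  have hle : ∀ c ∈ univ, rowFilling ν c ≤ T c := fun c _ => row_le_of_isSemistandard hT c
  have heq := (sum_eq_sum_iff_of_le hle).mp (le_antisymm (sum_le_sum hle) h)
  exact funext fun c => (heq c (mem_univ c)).symm

theorem eq_zero_of_sum_schur_eq_zero {c : YoungDiagram →₀ ℤ}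
    (h : (c.sum fun ν a => a • (straight ν).schur) = 0) : c = 0 := by
  by_contra hc
  obtain ⟨ν, hν, hmin⟩ := exists_min_image c.support (fun ν => ∑ b, rowFilling ν b)
    (Finsupp.support_nonempty_iff.mpr hc)
  set d := (straight ν).content (rowFilling ν)
  have hall : ∀ κ ∈ c.support, ∀ T ∈ (straight κ).tableaux d, κ = ν ∧ T = rowFilling κ := by
    intro κ hκ T hT
    have hTr : T = rowFilling κ := by
      refine eq_rowFilling_of_sum_le hT.1 ?_
      rw [← linearCombination_content, hT.2, linearCombination_content]
      exact hmin κ hκ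
    exact ⟨content_rowFilling_injective (hTr ▸ hT.2), hTr⟩
  have h1 := congrArg (MvPowerSeries.coeff d) h
  rw [Finsupp.sum, map_sum, map_zero, sum_eq_single_of_mem ν hν] at h1
  · have hone : (straight ν).tableaux d = {rowFilling ν} := by
      refine Set.eq_singleton_iff_unique_mem.mpr
        ⟨⟨rowFilling_isSemistandard ν, rfl⟩, fun T hT => (hall ν hν T hT).2⟩
    rw [map_zsmul] at h1
    have h2 : MvPowerSeries.coeff d (straight ν).schur = 1 := by
      change (((straight ν).tableaux d).ncard : ℤ) = 1
      rw [hone, Set.ncard_singleton, Nat.cast_one]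
    rw [h2, smul_eq_mul, mul_one] at h1
    exact Finsupp.mem_support_iff.mp hν h1
  · intro κ hκ hne
    have h2 : MvPowerSeries.coeff d (straight κ).schur = 0 := by
      change (((straight κ).tableaux d).ncard : ℤ) = 0
      rw [Set.eq_empty_of_forall_notMem fun T hT => hne (hall κ hκ T hT).1, Set.ncard_empty,
        Nat.cast_zero]
    rw [map_zsmul, h2, smul_zero]

theorem IsSchurExpansion.unique {A : SkewShape} {c c' : YoungDiagram →₀ ℤ}
    (h : A.IsSchurExpansion c) (h' : A.IsSchurExpansion c') : c = c' := by
  refine sub_eq_zero.mp (eq_zero_of_sum_schur_eq_zero ?_)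
  rw [Finsupp.sum_sub_index fun _ _ _ => sub_smul _ _ _]
  exact sub_eq_zero.mpr (h.symm.trans h')

theorem exists_isSchurExpansion (A : SkewShape) : ∃ c, A.IsSchurExpansion c ∧
    c (rowShape A) = 1 ∧ ∀ ν, c ν ≠ 0 → ν = rowShape A ∨ sqNorm (rowShape A) < sqNorm ν := by
  classical
  obtain ⟨c, hc, hsum⟩ := (Finsupp.mem_span_image_iff_linearCombination ℤ).mp
    (schurSeq_sub_mem_upperSpan A)
  have hzero : ∀ ν, c ν ≠ 0 → sqNorm (rowShape A) < sqNorm ν := fun ν hν =>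
    ((Finsupp.mem_supported ℤ c).mp hc (Finsupp.mem_support_iff.mpr hν)).2
  refine ⟨c + Finsupp.single (rowShape A) 1, isSchurExpansion_of_schurSeq ?_, ?_, ?_⟩
  · have := Finsupp.linearCombination_apply ℤ (v := fun κ => schurSeq (straight κ))
      (c + Finsupp.single (rowShape A) 1)
    rw [← this, map_add, hsum, Finsupp.linearCombination_single, one_smul, sub_add_cancel]
  · rw [Finsupp.add_apply, Finsupp.single_eq_same, add_eq_right]
    by_contra h
    exact lt_irrefl _ (hzero _ h)
  · intro ν hν
    refine or_iff_not_imp_left.mpr fun hne => hzero ν ?_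
    rwa [Finsupp.add_apply, Finsupp.single_eq_of_ne hne, add_zero] at hν

theorem rowShape_mem_schurSupport (A : SkewShape) : rowShape A ∈ A.schurSupport := by
  obtain ⟨c, hc, h1, -⟩ := exists_isSchurExpansion A
  exact ⟨c, hc, by rw [h1]; exact one_pos⟩

theorem eq_or_sqNorm_lt_of_mem_schurSupport {A : SkewShape} {ν : YoungDiagram}
    (hν : ν ∈ A.schurSupport) : ν = rowShape A ∨ sqNorm (rowShape A) < sqNorm ν := by
  obtain ⟨c, hc, -, h⟩ := exists_isSchurExpansion A
  obtain ⟨c', hc', hpos⟩ := hν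
  rw [hc'.unique hc] at hpos
  exact h ν hpos.ne'

theorem rowShape_eq_of_schurSupport_eq {A B : SkewShape} (h : A.schurSupport = B.schurSupport) :
    rowShape A = rowShape B := by
  rcases eq_or_sqNorm_lt_of_mem_schurSupport (h ▸ rowShape_mem_schurSupport A) with h1 | h1
  · exact h1
  rcases eq_or_sqNorm_lt_of_mem_schurSupport (h ▸ rowShape_mem_schurSupport B) with h2 | h2
  · exact h2.symm
  · exact absurd h1 h2.not_gt

theorem rowLengths_perm_of_rowShape_eq {A B : SkewShape} (h : rowShape A = rowShape B) :
    A.rowLengths.Perm B.rowLengths := by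
  have key : ∀ C : SkewShape, ((rowShape C).rowLens : Multiset ℕ) = C.rowLengths := fun C => by
    rw [rowShape, rowLens_shapeOf, Multiset.filter_eq_self]
    intro x hx
    have := (List.mem_filter.mp (Multiset.mem_coe.mp hx)).2
    exact Nat.pos_of_ne_zero (by simpa using this)
  rw [← Multiset.coe_eq_coe, ← key, ← key, h]

end SkewShape

theorem List.Perm.exists_eq_permuteRows {l l' : List ℕ} (h : l.Perm l') :
    ∃ π : Equiv.Perm (Fin l.length), l' = permuteRows l π := by
  have hl : l'.Perm ((List.finRange l.length).map l.get) := by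
    rw [List.map_get_finRange]
    exact h.symm
  obtain ⟨u, hu, hperm⟩ := (congrFun₂ (List.eq_map_comp_perm l.get) l' (List.finRange _)).mpr hl
  have hlen : u.length = l.length := hperm.length_eq.trans List.length_finRange
  have hinj : Function.Injective fun i : Fin l.length => u.get (i.cast hlen.symm) :=
    (List.nodup_iff_injective_get.mp (hperm.nodup_iff.mpr (List.nodup_finRange _))).comp
      (Fin.cast_injective _)
  refine ⟨(Equiv.ofBijective _ (Finite.injective_iff_bijective.mp hinj))⁻¹, ?_⟩
  rw [hu, permuteRows, inv_inv]
  refine List.ext_getElem (by simp [hlen]) fun i h1 h2 => ?_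
  simp

theorem mainTheorem4 (A B : SkewShape) (hA : A.IsRibbon) (hB : B.IsRibbon)
    (hsupp : A.schurSupport = B.schurSupport) :
    ∃ π : Equiv.Perm (Fin A.rowLengths.length),
      B.rowLengths = permuteRows A.rowLengths π :=
  (SkewShape.rowLengths_perm_of_rowShape_eq
    (SkewShape.rowShape_eq_of_schurSupport_eq hsupp)).exists_eq_permuteRows
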